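/- **Definitions.** Let $w = w_1\cdots w_n \in \{0,1\}^n$. Slot $i \in \{1,\dots,n\}$ is *honest* if $w_i = 0$ and *adversarial* if $w_i = 1$. A *fork* for $w$ is a finite tree $F$, with edges directed away from a root $r$, and a labeling $\ell$ of its vertices by $\{0,1,\dots,n\}$ such that: $\ell(r) = 0$; labels strictly increase along directed paths; each honest slot is the label of exactly one vertex; and if $i<j$ are honest slots, then the vertex labeled $i$ has strictly smaller depth than the vertex labeled $j$. A *tine* is a directed path starting at the root; its length is its number of edges; the height of $F$ is the length of a longest tine. Two (not necessarily distinct) tines are *disjoint* if they share no edge. $F$ is *balanced* if it has two disjoint tines whose lengths both equal the height of $F$. $F$ is *closed* if each of its leaves is labeled with an honest slot; the fork consisting of the root alone is also considered closed. For a tine $t$ of a closed fork $F$ for $w$ with last vertex $v$, put $$\mathrm{reach}(t) = |\{i : w_i = 1,\ i > \ell(v)\}| - \bigl(\mathrm{height}(F) - \mathrm{length}(t)\bigr).$$ The *margin* of $w$ is $\mu(w) = \max_F \max_{t_1,t_2} \min\{\mathrm{reach}(t_1), \mathrm{reach}(t_2)\}$, where $F$ ranges over the closed forks for $w$ and $(t_1,t_2)$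 over the pairs of disjoint tines of $F$. The string $w$ is *forkable* if there is a balanced fork for $w$. A random variable $W = (W_1,\dots,W_n)$ with values in $\{0,1\}^n$ satisfies the *$\epsilon$-martingale condition* if $\Pr[W_t = 1 \mid W_1,\dots,W_{t-1}] \le (1-\epsilon)/2$ for each $t \in \{1,\dots,n\}$, whatever the values of $W_1,\dots,W_{t-1}$ on which one conditions. **Statement.** For every $\epsilon \in (0,1)$ there is a constant $c > 0$, depending only on $\epsilon$, such that for every $n \ge 0$ and every random variable $w$ with values in $\{0,1\}^n$ that satisfies the $\epsilon$-martingale condition, $$\Pr[w \text{ is forkable}] = \Pr[\mu(w) \ge 0] \le \exp(-c\,n).$$ -/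

import Mathlib

open MeasureTheory ProbabilityTheory

/-- Characteristic strings `w ∈ {0,1}^n`. The slots are `1, …, n`; slot `i + 1` (that is,
`i.succ : Fin (n + 1)`) carries the bit `w i`, where `false` is `0` (honest) and `true` is `1`
(adversarial). -/
abbrev CharString (n : ℕ) : Type := Fin n → Bool

/-- A fork `F ⊢ w`: a finite rooted tree, directed away from the root, whose vertices carry labels
in `{0, …, n}`. The tree is given by its root and its parent map: the edges are the pairs
`(parent v, v)` with `v ≠ root`, and the value `parent root = root` is only a convention. -/
structure Fork {n : ℕ} (w : CharString n) where
  /-- The vertices. -/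
  V : Type
  [fintypeV : Fintype V]
  root : V
  parent : V → V
  parent_root : parent root = root
  /-- Every vertex is reached from the root, so the graph is a tree. -/
  exists_iterate_parent : ∀ v, ∃ k : ℕ, parent^[k] v = root
  label : V → Fin (n + 1)
  /-- The root has label `0`. -/
  label_root : label root = 0
  /-- Labels are strictly increasing along directed paths. -/
  label_lt : ∀ v, v ≠ root → label (parent v) < label v
  /-- Every honest slot is the label of exactly one vertex. -/
  honest_unique : ∀ i, w i = false → ∃! v, label v = i.succ
  /-- The depth (distance to the root) of honest vertices is strictly increasing. -/
  honest_depth : ∀ i j, w i = false → w j = false → i < j →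
    ∀ u v, label u = i.succ → label v = j.succ →
      sInf {k : ℕ | parent^[k] u = root} < sInf {k : ℕ | parent^[k] v = root}

attribute [instance] Fork.fintypeV

namespace Fork

variable {n : ℕ} {w : CharString n} (F : Fork w)

/-- There is an edge from `u` to `v`. -/
def Edge (u v : F.V) : Prop := v ≠ F.root ∧ F.parent v = u

/-- The number of edges of the path from the root to `v`. A tine (directed path starting from the
root) is represented by the vertex at which it terminates, so this is also the length of the
tine. -/
noncomputable def depth (v : F.V) : ℕ := sInf {k : ℕ | F.parent^[k] v = F.root}

/-- The vertex `u` lies on the tine that terminates at `t`. -/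
def OnTine (u t : F.V) : Prop := ∃ k : ℕ, F.parent^[k] t = u

/-- The tines that terminate at `t₁` and `t₂` share an edge. (The edge that enters `v` belongs to
a tine exactly when `v` lies on it.) -/
def ShareEdge (t₁ t₂ : F.V) : Prop :=
  ∃ u v, F.Edge u v ∧ F.OnTine v t₁ ∧ F.OnTine v t₂

/-- The length of the longest tine. -/
noncomputable def height : ℕ := Finset.univ.sup F.depth

/-- Two edge-disjoint tines have maximum length. -/
def IsBalanced : Prop :=
  ∃ t₁ t₂, ¬ F.ShareEdge t₁ t₂ ∧ F.depth t₁ = F.height ∧ F.depth t₂ = F.height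

/-- Every leaf is honest, i.e. is labeled with an honest slot; the trivial fork, in which the root
is a leaf, counts as closed. -/
def IsClosed : Prop :=
  ∀ v, (∀ u, ¬ F.Edge v u) → v = F.root ∨ ∃ i, w i = false ∧ F.label v = i.succ

/-- The length of the longest tine minus the length of `t`. -/
noncomputable def gap (t : F.V) : ℤ := (F.height : ℤ) - (F.depth t : ℤ)

/-- The number of adversarial slots after the last vertex of the tine. -/
def reserve (t : F.V) : ℕ :=
  (Finset.univ.filter fun i : Fin n => w i = true ∧ F.label t < i.succ).card

/-- Reserve minus gap. -/
noncomputable def reach (t : F.V) : ℤ := (F.reserve t : ℤ) - F.gap t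

/-- The margin of a fork: the maximum of `min (reach t₁) (reach t₂)` over all pairs of disjoint
tines. -/
noncomputable def margin : ℤ :=
  sSup {m : ℤ | ∃ t₁ t₂, ¬ F.ShareEdge t₁ t₂ ∧ m = min (F.reach t₁) (F.reach t₂)}

end Fork

namespace CharString

/-- The margin `μ(w)`: the maximum of the margins of the closed forks for `w`. -/
noncomputable def margin {n : ℕ} (w : CharString n) : ℤ :=
  sSup {m : ℤ | ∃ F : Fork w, F.IsClosed ∧ m = F.margin}

/-- A string is forkable if there is a balanced fork for it. -/
def Forkable {n : ℕ} (w : CharString n) : Prop := ∃ F : Fork w, F.IsBalanced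

end CharString

/-- The `ε`-martingale condition for a random string `W`: `Pr[W_t = 1 | W_1, …, W_{t-1}]` is at
most `(1 - ε) / 2`, whatever the (possible) values `a` of the earlier bits. -/
def MartingaleCondition (ε : ℝ) {Ω : Type*} [MeasurableSpace Ω] (P : Measure Ω) {n : ℕ}
    (W : Ω → CharString n) : Prop :=
  ∀ (t : Fin n) (a : CharString n), P {ω | ∀ i < t, W ω i = a i} ≠ 0 →
    (P[|{ω | ∀ i < t, W ω i = a i}]).real {ω | W ω t = true} ≤ (1 - ε) / 2

/-! The argument combines a combinatorial bound on forks with a supermartingale.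

For any fork, keep the vertices labeled at most `m` and measure reach against the deepest honest
vertex among the first `m` slots (`reachUpTo`). Let ρ bound the reach of all tines and μ the smaller
reach in any disjoint pair. An adversarial slot raises both bounds by at most one. An honest slot
adds one vertex, of reach zero and deeper than all earlier honest ones, so every old tine loses at
least one. This yields the recurrence `boundStep`; by `reachUpTo_le_bounds` and
`IsBalanced.bounds_nonneg`, a forkable string has a nonnegative final μ. Only upper bounds are
needed, never optimal forks.

Forkability is equivalent to nonnegative margin. Pruning a balanced fork to a closed one trades each
removed adversarial vertex for a unit of reserve (`exists_hasHonest_onTine`). Conversely,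
nonnegative reach means that there is enough reserve to lengthen both tines to the full height
(`forkable_of_reach_nonneg`).

Finally, the potential (1 + ε²)^ρ (1 + ε)^min(μ, 0) shrinks in expectation by the factor 1 - ε⁴/2 at
each step (`potential_drift`). It starts at 1 and is at least 1 whenever μ ≥ 0, so Markov's
inequality bounds the probability by (1 - ε⁴/2)^n, and c = ε⁴/2 works. -/

namespace Fork

variable {n : ℕ} {w : CharString n} (F : Fork w)

/-! ### Depth, tines and shared edges in a fork -/

lemma iterate_parent_root (k : ℕ) : F.parent^[k] F.root = F.root :=
  Function.iterate_fixed F.parent_root k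

lemma depth_root : F.depth F.root = 0 :=
  Nat.sInf_eq_zero.2 (Or.inl rfl)

lemma depth_eq_succ {v : F.V} (hv : v ≠ F.root) : F.depth v = F.depth (F.parent v) + 1 := by
  have hmem : F.parent^[F.depth v] v = F.root := Nat.sInf_mem (F.exists_iterate_parent v)
  have hmem' : F.parent^[F.depth (F.parent v)] (F.parent v) = F.root :=
    Nat.sInf_mem (F.exists_iterate_parent (F.parent v))
  apply le_antisymm
  · exact Nat.sInf_le (by simpa [Function.iterate_succ_apply] using hmem')
  · obtain ⟨k, hk⟩ : ∃ k, F.depth v = k + 1 := by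
      refine Nat.exists_eq_succ_of_ne_zero fun h => hv ?_
      simpa [h] using hmem
    rw [hk, Function.iterate_succ_apply] at hmem
    have : F.depth (F.parent v) ≤ k := Nat.sInf_le hmem
    omega

/-- Induction along the edges of the tree. -/
lemma parent_induction {C : F.V → Prop} (root : C F.root)
    (step : ∀ v, v ≠ F.root → C (F.parent v) → C v) (v : F.V) : C v := by
  obtain ⟨k, hk⟩ := F.exists_iterate_parent v
  induction k generalizing v with
  | zero => exact (show v = F.root from hk) ▸ root
  | succ k ih =>
    by_cases hv : v = F.root
    · exact hv ▸ root
    · exact step v hv (ih _ (by simpa [Function.iterate_succ_apply] using hk))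

lemma ne_root_of_label {v : F.V} {i : Fin n} (h : F.label v = i.succ) : v ≠ F.root := by
  rintro rfl
  rw [F.label_root] at h
  exact (Fin.succ_ne_zero i) h.symm

lemma exists_succ_of_ne_root {v : F.V} (hv : v ≠ F.root) : ∃ i : Fin n, F.label v = i.succ := by
  have h : F.label v ≠ 0 := ((Fin.zero_le _).trans_lt (F.label_lt v hv)).ne'
  obtain ⟨i, hi⟩ := Fin.exists_succ_eq.2 h
  exact ⟨i, hi.symm⟩

lemma depth_le_height (v : F.V) : F.depth v ≤ F.height := Finset.le_sup (Finset.mem_univ v)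

lemma onTine_refl (v : F.V) : F.OnTine v v := ⟨0, rfl⟩

lemma OnTine.of_parent {u v : F.V} (h : F.OnTine u (F.parent v)) : F.OnTine u v := by
  obtain ⟨k, hk⟩ := h
  exact ⟨k + 1, by simpa [Function.iterate_succ_apply] using hk⟩

lemma OnTine.trans {u v t : F.V} (h : F.OnTine u v) (h' : F.OnTine v t) : F.OnTine u t := by
  obtain ⟨k, hk⟩ := h
  obtain ⟨l, hl⟩ := h'
  exact ⟨k + l, by rw [Function.iterate_add_apply, hl, hk]⟩

lemma ShareEdge.mono {s₁ s₂ t₁ t₂ : F.V} (h : F.ShareEdge s₁ s₂) (h₁ : F.OnTine s₁ t₁)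
    (h₂ : F.OnTine s₂ t₂) : F.ShareEdge t₁ t₂ := by
  obtain ⟨u, v, e, a, b⟩ := h
  exact ⟨u, v, e, a.trans F h₁, b.trans F h₂⟩

lemma ShareEdge.symm {t₁ t₂ : F.V} (h : F.ShareEdge t₁ t₂) : F.ShareEdge t₂ t₁ := by
  obtain ⟨u, v, e, a, b⟩ := h
  exact ⟨u, v, e, b, a⟩

lemma shareEdge_self {t : F.V} (ht : t ≠ F.root) : F.ShareEdge t t :=
  ⟨_, t, ⟨ht, rfl⟩, F.onTine_refl t, F.onTine_refl t⟩

lemma not_shareEdge_root : ¬ F.ShareEdge F.root F.root := by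
  rintro ⟨u, v, ⟨hv, -⟩, ⟨k, hk⟩, -⟩
  exact hv (by rw [← hk, iterate_parent_root])

/-! ### Reach with respect to a prefix -/

/-- The largest depth of a vertex labeled with an honest slot among the first `m` ones. -/
noncomputable def honestHeight (m : ℕ) : ℕ :=
  open Classical in
  (Finset.univ.filter fun v => ∃ i : Fin n, w i = false ∧ F.label v = i.succ ∧ i.val < m).sup
    F.depth

/-- The number of adversarial slots after `t` among the first `m` ones. -/
def reserveUpTo (m : ℕ) (t : F.V) : ℕ :=
  (Finset.univ.filter fun i : Fin n => w i = true ∧ F.label t < i.succ ∧ i.val < m).card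

/-- The reach of a tine with respect to the first `m` slots. -/
noncomputable def reachUpTo (m : ℕ) (t : F.V) : ℤ :=
  F.reserveUpTo m t - (F.honestHeight m - F.depth t)

lemma honestHeight_le_height (m : ℕ) : F.honestHeight m ≤ F.height :=
  Finset.sup_mono (Finset.subset_univ _)

lemma reserveUpTo_top (t : F.V) : F.reserveUpTo n t = F.reserve t := by
  simp [reserveUpTo, reserve]

lemma reserveUpTo_parent {m : ℕ} {v : F.V} {i : Fin n} (hi : F.label v = i.succ)
    (hw : w i = true) (him : i.val < m) :
    F.reserveUpTo m v + 1 ≤ F.reserveUpTo m (F.parent v) := by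
  have hlt := F.label_lt v (F.ne_root_of_label hi)
  refine Finset.card_lt_card (Finset.ssubset_iff_of_subset ?_ |>.2 ⟨i, ?_, ?_⟩)
  · intro j hj
    simp only [Finset.mem_filter, Finset.mem_univ, true_and] at hj ⊢
    exact ⟨hj.1, hlt.trans hj.2.1, hj.2.2⟩
  · simp only [Finset.mem_filter, Finset.mem_univ, true_and]
    exact ⟨hw, hi ▸ hlt, him⟩
  · simp [hi]

/-- An adversarial vertex gains one unit of depth but uses up at least one slot of its parent's
reserve. -/
lemma reachUpTo_le_parent {m : ℕ} {v : F.V} {i : Fin n} (hi : F.label v = i.succ)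
    (hw : w i = true) (him : i.val < m) : F.reachUpTo m v ≤ F.reachUpTo m (F.parent v) := by
  have h₁ := F.reserveUpTo_parent hi hw him
  have h₂ := F.depth_eq_succ (F.ne_root_of_label hi)
  unfold reachUpTo
  omega

lemma reserveUpTo_succ_of_true {m : ℕ} (hm : m < n) (hw : w ⟨m, hm⟩ = true) {t : F.V}
    (ht : (F.label t).val ≤ m) : F.reserveUpTo (m + 1) t = F.reserveUpTo m t + 1 := by
  unfold reserveUpTo
  rw [← Finset.card_insert_of_notMem (a := (⟨m, hm⟩ : Fin n)) (by simp)]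
  congr 1
  ext i
  simp only [Finset.mem_insert, Finset.mem_filter, Finset.mem_univ, true_and, Fin.ext_iff,
    Fin.lt_def, Fin.val_succ]
  constructor
  · rintro ⟨h₁, h₂, h₃⟩
    by_cases h : i.val = m
    · exact Or.inl h
    · exact Or.inr ⟨h₁, h₂, by omega⟩
  · rintro (h | ⟨h₁, h₂, h₃⟩)
    · obtain rfl : i = ⟨m, hm⟩ := Fin.ext h
      exact ⟨hw, by simpa using Nat.lt_succ_of_le ht, by simp⟩
    · exact ⟨h₁, h₂, by omega⟩

lemma reserveUpTo_succ_of_false {m : ℕ} (hm : m < n) (hw : w ⟨m, hm⟩ = false) (t : F.V) :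
    F.reserveUpTo (m + 1) t = F.reserveUpTo m t := by
  unfold reserveUpTo
  congr 1
  ext i
  simp only [Finset.mem_filter, Finset.mem_univ, true_and]
  refine and_congr_right fun h₁ => and_congr_right fun _ => ⟨fun h => ?_, fun h => by omega⟩
  refine lt_of_le_of_ne (Nat.lt_succ_iff.1 h) fun h' => ?_
  obtain rfl : i = ⟨m, hm⟩ := Fin.ext h'
  simp [hw] at h₁

lemma honestHeight_succ_of_true {m : ℕ} (hm : m < n) (hw : w ⟨m, hm⟩ = true) :
    F.honestHeight (m + 1) = F.honestHeight m := by
  unfold honestHeight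
  congr 1
  ext v
  simp only [Finset.mem_filter, Finset.mem_univ, true_and]
  refine exists_congr fun i => and_congr_right fun h₁ => and_congr_right fun _ =>
    ⟨fun h => ?_, fun h => by omega⟩
  refine lt_of_le_of_ne (Nat.lt_succ_iff.1 h) fun h' => ?_
  obtain rfl : i = ⟨m, hm⟩ := Fin.ext h'
  simp [hw] at h₁

lemma honestHeight_lt_depth {m : ℕ} (hm : m < n) (hw : w ⟨m, hm⟩ = false) {v : F.V}
    (hv : F.label v = Fin.succ ⟨m, hm⟩) : F.honestHeight m < F.depth v := by
  -- If there is no earlier honest vertex, the supremum is the default `0`, so positivity is needed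
  -- separately.
  have hpos : 0 < F.depth v := by
    rw [F.depth_eq_succ (F.ne_root_of_label hv)]
    omega
  refine (Finset.sup_lt_iff hpos).2 fun u hu => ?_
  obtain ⟨i, h₁, h₂, h₃⟩ := (Finset.mem_filter.1 hu).2
  exact F.honest_depth i ⟨m, hm⟩ h₁ hw h₃ u v h₂ hv

lemma honestHeight_succ_of_false {m : ℕ} (hm : m < n) (hw : w ⟨m, hm⟩ = false) {v : F.V}
    (hv : F.label v = Fin.succ ⟨m, hm⟩) : F.honestHeight (m + 1) = F.depth v := by
  apply le_antisymm
  · refine Finset.sup_le fun u hu => ?_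
    obtain ⟨i, h₁, h₂, h₃⟩ := (Finset.mem_filter.1 hu).2
    rcases eq_or_lt_of_le (Nat.lt_succ_iff.1 h₃) with h | h
    · obtain rfl : i = ⟨m, hm⟩ := Fin.ext h
      rw [(F.honest_unique _ hw).unique h₂ hv]
    · exact (F.honest_depth i ⟨m, hm⟩ h₁ hw h u v h₂ hv).le
  · exact Finset.le_sup (Finset.mem_filter.2 ⟨Finset.mem_univ _, ⟨m, hm⟩, hw, hv, by simp⟩)

end Fork

/-! ### The recurrence for the bounds -/

namespace CharString

/-- One step of the recurrence for upper bounds on the reach and the margin. -/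
def boundStep (b : Bool) (s : ℤ × ℤ) : ℤ × ℤ :=
  if b then (s.1 + 1, s.2 + 1)
  else (max (s.1 - 1) 0, if 0 < s.1 ∧ s.2 = 0 then 0 else s.2 - 1)

/-- Upper bounds on the reach and on the margin, computed by a recurrence. -/
def bounds : {n : ℕ} → CharString n → ℤ × ℤ
  | 0, _ => (0, 0)
  | n + 1, w => boundStep (w (Fin.last n)) (bounds (n := n) (Fin.init w))

lemma bounds_fst_nonneg : ∀ {n : ℕ} (w : CharString n), 0 ≤ w.bounds.1
  | 0, _ => le_rfl
  | n + 1, w => by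
    have := bounds_fst_nonneg (n := n) (Fin.init w)
    rw [bounds, boundStep]
    split_ifs <;> simp only <;> omega

/-- In `potential_drift` this excludes a positive margin bound at reach bound zero. -/
lemma bounds_snd_le_fst : ∀ {n : ℕ} (w : CharString n), w.bounds.2 ≤ w.bounds.1
  | 0, _ => le_rfl
  | n + 1, w => by
    have := bounds_snd_le_fst (n := n) (Fin.init w)
    rw [bounds, boundStep]
    split_ifs <;> simp only <;> omega

/-- The first `m` bits of a string. -/
def take {n : ℕ} (w : CharString n) (m : ℕ) (hm : m ≤ n) : CharString m :=
  fun i => w (Fin.castLE hm i)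

lemma bounds_take_succ {n : ℕ} (w : CharString n) (m : ℕ) (hm : m < n) :
    (w.take (m + 1) hm).bounds = boundStep (w ⟨m, hm⟩) (w.take m hm.le).bounds := rfl

end CharString

/-! ### Validity of the bounds for every fork -/

namespace Fork

variable {n : ℕ} {w : CharString n} (F : Fork w)

/-- Old tines gain one slot of reserve. A tine ending in a new vertex does no better than its
parent, and passing to initial segments preserves disjointness. -/
lemma reachUpTo_succ_le_bounds_of_true {m : ℕ} (hm : m < n) (hw : w ⟨m, hm⟩ = true) {ρ μ : ℤ}
    (hρ : ∀ t, (F.label t).val ≤ m → F.reachUpTo m t ≤ ρ)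
    (hμ : ∀ t₁ t₂, (F.label t₁).val ≤ m → (F.label t₂).val ≤ m → ¬ F.ShareEdge t₁ t₂ →
      min (F.reachUpTo m t₁) (F.reachUpTo m t₂) ≤ μ) :
    (∀ t, (F.label t).val ≤ m + 1 → F.reachUpTo (m + 1) t ≤ ρ + 1) ∧
    ∀ t₁ t₂, (F.label t₁).val ≤ m + 1 → (F.label t₂).val ≤ m + 1 → ¬ F.ShareEdge t₁ t₂ →
      min (F.reachUpTo (m + 1) t₁) (F.reachUpTo (m + 1) t₂) ≤ μ + 1 := by
  have key : ∀ t, (F.label t).val ≤ m + 1 → ∃ s, F.OnTine s t ∧ (F.label s).val ≤ m ∧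
      F.reachUpTo (m + 1) t ≤ F.reachUpTo m s + 1 := by
    have old : ∀ t, (F.label t).val ≤ m → F.reachUpTo (m + 1) t = F.reachUpTo m t + 1 := by
      intro t ht
      have h₁ := F.reserveUpTo_succ_of_true hm hw ht
      have h₂ := F.honestHeight_succ_of_true hm hw
      unfold reachUpTo
      omega
    intro t ht
    rcases Nat.lt_or_ge m (F.label t).val with h | h
    · have hl : F.label t = Fin.succ ⟨m, hm⟩ := Fin.ext (by simp; omega)
      have hp := F.label_lt t (F.ne_root_of_label hl)
      have hp' : (F.label (F.parent t)).val ≤ m := by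
        rw [hl] at hp
        exact Nat.lt_succ_iff.1 hp
      exact ⟨F.parent t, ⟨1, rfl⟩, hp', old _ hp' ▸ F.reachUpTo_le_parent hl hw (by simp)⟩
    · exact ⟨t, F.onTine_refl t, h, (old t h).le⟩
  constructor
  · intro t ht
    obtain ⟨s, -, hs, h⟩ := key t ht
    have := hρ s hs
    omega
  · intro t₁ t₂ ht₁ ht₂ hd
    obtain ⟨s₁, ho₁, hs₁, h₁⟩ := key t₁ ht₁
    obtain ⟨s₂, ho₂, hs₂, h₂⟩ := key t₂ ht₂
    have := hμ s₁ s₂ hs₁ hs₂ fun h => hd (h.mono F ho₁ ho₂)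
    omega

/-- The new honest vertex `v` sets the new honest height, so its reach is zero and every old tine
loses at least one. Its parent is at least as deep as all earlier honest vertices, hence had
nonnegative reach; this controls the pairs that contain `v`. -/
lemma reachUpTo_succ_le_bounds_of_false {m : ℕ} (hm : m < n) (hw : w ⟨m, hm⟩ = false)
    {ρ μ : ℤ}
    (hρ : ∀ t, (F.label t).val ≤ m → F.reachUpTo m t ≤ ρ)
    (hμ : ∀ t₁ t₂, (F.label t₁).val ≤ m → (F.label t₂).val ≤ m → ¬ F.ShareEdge t₁ t₂ →
      min (F.reachUpTo m t₁) (F.reachUpTo m t₂) ≤ μ) :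
    (∀ t, (F.label t).val ≤ m + 1 → F.reachUpTo (m + 1) t ≤ max (ρ - 1) 0) ∧
    ∀ t₁ t₂, (F.label t₁).val ≤ m + 1 → (F.label t₂).val ≤ m + 1 → ¬ F.ShareEdge t₁ t₂ →
      min (F.reachUpTo (m + 1) t₁) (F.reachUpTo (m + 1) t₂) ≤
        if 0 < ρ ∧ μ = 0 then 0 else μ - 1 := by
  obtain ⟨v, hv, hvu⟩ := F.honest_unique _ hw
  have hH := F.honestHeight_lt_depth hm hw hv
  have hH' := F.honestHeight_succ_of_false hm hw hv
  have old : ∀ t, F.reachUpTo (m + 1) t ≤ F.reachUpTo m t - 1 := by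
    intro t
    have h₁ := F.reserveUpTo_succ_of_false hm hw t
    unfold reachUpTo
    omega
  have hv0 : F.reachUpTo (m + 1) v = 0 := by
    have : F.reserveUpTo (m + 1) v = 0 := by
      simp only [reserveUpTo, Finset.card_eq_zero, Finset.filter_eq_empty_iff, hv, Fin.lt_def,
        Fin.val_succ]
      rintro i - ⟨-, h₁, h₂⟩
      omega
    unfold reachUpTo
    omega
  have hvr := F.ne_root_of_label hv
  have hpl : (F.label (F.parent v)).val ≤ m := by
    have hp := F.label_lt v hvr
    rw [hv] at hp
    exact Nat.lt_succ_iff.1 hp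
  have hp0 : 0 ≤ F.reachUpTo m (F.parent v) := by
    have := F.depth_eq_succ hvr
    unfold reachUpTo
    omega
  have cases_t : ∀ t, (F.label t).val ≤ m + 1 → t = v ∨ (F.label t).val ≤ m := by
    intro t ht
    rcases Nat.lt_or_ge m (F.label t).val with h | h
    · exact Or.inl (hvu t (Fin.ext (by simp; omega)))
    · exact Or.inr h
  -- Compare with the pair formed by `F.parent v` and `t`. If μ < 0, then `t` itself had reach at
  -- most μ and drops further; if ρ ≤ 0 = μ, it drops below zero; if μ > 0, the zero reach of `v`
  -- suffices.
  have hvt : ∀ t, (F.label t).val ≤ m → ¬ F.ShareEdge v t →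
      min 0 (F.reachUpTo (m + 1) t) ≤ if 0 < ρ ∧ μ = 0 then 0 else μ - 1 := by
    intro t ht hd
    have h₁ := hμ _ t hpl ht fun h => hd (h.mono F ⟨1, rfl⟩ (F.onTine_refl t))
    have h₂ := hρ t ht
    have h₃ := old t
    split_ifs <;> omega
  constructor
  · intro t ht
    rcases cases_t t ht with rfl | h
    · omega
    · have := hρ t h
      have := old t
      omega
  · intro t₁ t₂ ht₁ ht₂ hd
    rcases cases_t t₁ ht₁ with rfl | h₁ <;> rcases cases_t t₂ ht₂ with rfl | h₂
    · exact absurd (F.shareEdge_self hvr) hd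
    · rw [hv0]
      exact hvt _ h₂ hd
    · rw [hv0, min_comm]
      exact hvt _ h₁ fun h => hd (h.symm F)
    · have h₃ := hμ _ _ h₁ h₂ hd
      have h₄ := old t₁
      have h₅ := old t₂
      split_ifs <;> omega

lemma reachUpTo_le_bounds (m : ℕ) (hm : m ≤ n) :
    (∀ t, (F.label t).val ≤ m → F.reachUpTo m t ≤ (w.take m hm).bounds.1) ∧
    ∀ t₁ t₂, (F.label t₁).val ≤ m → (F.label t₂).val ≤ m → ¬ F.ShareEdge t₁ t₂ →
      min (F.reachUpTo m t₁) (F.reachUpTo m t₂) ≤ (w.take m hm).bounds.2 := by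
  induction m with
  | zero =>
    have h : ∀ t, (F.label t).val ≤ 0 → F.reachUpTo 0 t ≤ 0 := by
      intro t ht
      have hr : t = F.root := by
        by_contra h
        obtain ⟨i, hi⟩ := F.exists_succ_of_ne_root h
        simp [hi] at ht
      simp [reachUpTo, hr, depth_root, reserveUpTo]
    exact ⟨h, fun t₁ _ h₁ _ _ => (min_le_left _ _).trans (h t₁ h₁)⟩
  | succ m ih =>
    obtain ⟨hρ, hμ⟩ := ih (Nat.le_of_succ_le hm)
    rw [w.bounds_take_succ m hm]
    cases hw : w ⟨m, hm⟩ with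
    | true => exact F.reachUpTo_succ_le_bounds_of_true hm hw hρ hμ
    | false => exact F.reachUpTo_succ_le_bounds_of_false hm hw hρ hμ

lemma IsBalanced.bounds_nonneg (h : F.IsBalanced) : 0 ≤ w.bounds.2 := by
  obtain ⟨t₁, t₂, hd, h₁, h₂⟩ := h
  have hb := (F.reachUpTo_le_bounds n le_rfl).2 t₁ t₂ (Nat.lt_succ_iff.1 (F.label t₁).2)
    (Nat.lt_succ_iff.1 (F.label t₂).2) hd
  refine le_trans ?_ hb
  have hH := F.honestHeight_le_height n
  unfold reachUpTo
  omega

/-! ### Pruning a fork to a closed one -/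

/-- The vertex is the root or lies on a tine that ends in an honest vertex. -/
def HasHonest (v : F.V) : Prop :=
  v = F.root ∨ ∃ u i, w i = false ∧ F.label u = i.succ ∧ F.OnTine v u

lemma HasHonest.parent {v : F.V} (h : F.HasHonest v) : F.HasHonest (F.parent v) := by
  rcases h with rfl | ⟨u, i, hw, hl, k, hk⟩
  · exact Or.inl F.parent_root
  · exact Or.inr ⟨u, i, hw, hl, k + 1, by rw [Function.iterate_succ_apply', hk]⟩

lemma hasHonest_of_label {v : F.V} {i : Fin n} (hw : w i = false) (h : F.label v = i.succ) :
    F.HasHonest v :=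
  Or.inr ⟨v, i, hw, h, F.onTine_refl v⟩

/-- The parent map restricted to the vertices with honest descendants. -/
def pruneParent (v : {v // F.HasHonest v}) : {v // F.HasHonest v} :=
  ⟨F.parent v.1, v.2.parent F⟩

lemma coe_iterate_pruneParent (k : ℕ) (v : {v // F.HasHonest v}) :
    ((F.pruneParent^[k] v).1 : F.V) = F.parent^[k] v.1 := by
  induction k generalizing v with
  | zero => rfl
  | succ k ih => rw [Function.iterate_succ_apply, ih, Function.iterate_succ_apply]; rfl

lemma iterate_pruneParent_eq_root_iff (k : ℕ) (v : {v // F.HasHonest v}) :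
    F.pruneParent^[k] v = ⟨F.root, Or.inl rfl⟩ ↔ F.parent^[k] v.1 = F.root := by
  rw [Subtype.ext_iff, coe_iterate_pruneParent]

/-- The largest closed fork contained in `F`. -/
noncomputable def prune : Fork w where
  V := {v // F.HasHonest v}
  fintypeV := Fintype.ofFinite _
  root := ⟨F.root, Or.inl rfl⟩
  parent := F.pruneParent
  parent_root := Subtype.ext F.parent_root
  exists_iterate_parent v := by
    obtain ⟨k, hk⟩ := F.exists_iterate_parent v.1
    exact ⟨k, (F.iterate_pruneParent_eq_root_iff k v).2 hk⟩
  label v := F.label v.1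
  label_root := F.label_root
  label_lt v hv := F.label_lt v.1 fun h => hv (Subtype.ext h)
  honest_unique i hi := by
    obtain ⟨v, hv, hu⟩ := F.honest_unique i hi
    exact ⟨⟨v, F.hasHonest_of_label hi hv⟩, hv, fun u h => Subtype.ext (hu u.1 h)⟩
  honest_depth i j hi hj hij u v hu hv := by
    simp only [iterate_pruneParent_eq_root_iff]
    exact F.honest_depth i j hi hj hij u.1 v.1 hu hv

lemma depth_prune (v : {v // F.HasHonest v}) : F.prune.depth v = F.depth v.1 :=
  congrArg sInf (Set.ext fun k => F.iterate_pruneParent_eq_root_iff k v)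

lemma height_prune_le : F.prune.height ≤ F.height :=
  Finset.sup_le fun v _ => (F.depth_prune v).trans_le (F.depth_le_height v.1)

lemma ShareEdge.of_prune {t₁ t₂ : {v // F.HasHonest v}} (h : F.prune.ShareEdge t₁ t₂) :
    F.ShareEdge t₁.1 t₂.1 := by
  obtain ⟨u, v, ⟨hv, -⟩, ⟨k, hk⟩, ⟨l, hl⟩⟩ := h
  refine ⟨_, v.1, ⟨fun h => hv (Subtype.ext h), rfl⟩, ⟨k, ?_⟩, ⟨l, ?_⟩⟩
  · rw [← coe_iterate_pruneParent]
    exact congrArg Subtype.val hk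
  · rw [← coe_iterate_pruneParent]
    exact congrArg Subtype.val hl

lemma prune_isClosed : F.prune.IsClosed := by
  rintro ⟨v, hv⟩ hleaf
  rcases hv with rfl | ⟨u, i, hw, hl, k, hk⟩
  · exact Or.inl rfl
  by_cases hvr : v = F.root
  · exact Or.inl (Subtype.ext hvr)
  cases k with
  | zero =>
    obtain rfl : u = v := hk
    exact Or.inr ⟨i, hw, hl⟩
  | succ k =>
    -- The next vertex on the way to the honest descendant `u` survives the pruning, so `v` is not a
    -- leaf.
    refine absurd ?_ (hleaf ⟨F.parent^[k] u, Or.inr ⟨u, i, hw, hl, k, rfl⟩⟩)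
    rw [Function.iterate_succ_apply'] at hk
    refine ⟨fun h => hvr ?_, Subtype.ext hk⟩
    rw [← hk, show F.parent^[k] u = F.root from congrArg Subtype.val h, F.parent_root]

/-- Walk up from `t` until a vertex survives the pruning. Every vertex left behind is adversarial,
so each step loses one unit of depth and regains at least one of reserve. -/
lemma exists_hasHonest_onTine (t : F.V) :
    ∃ s, F.HasHonest s ∧ F.OnTine s t ∧ F.reserve t + F.depth t ≤ F.reserve s + F.depth s := by
  induction t using F.parent_induction with
  | root => exact ⟨F.root, Or.inl rfl, F.onTine_refl _, le_rfl⟩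
  | step t ht ih =>
    by_cases h : F.HasHonest t
    · exact ⟨t, h, F.onTine_refl _, le_rfl⟩
    obtain ⟨s, hs, ho, hle⟩ := ih
    refine ⟨s, hs, ho.of_parent F, ?_⟩
    obtain ⟨i, hi⟩ := F.exists_succ_of_ne_root ht
    have hw : w i = true := by
      by_contra hw
      exact h (F.hasHonest_of_label (by simpa using hw) hi)
    have h₁ := F.reserveUpTo_parent hi hw i.2
    have h₂ := F.depth_eq_succ ht
    simp only [reserveUpTo_top] at h₁
    omega

lemma IsBalanced.exists_closed (h : F.IsBalanced) :
    ∃ G : Fork w, G.IsClosed ∧ ∃ t₁ t₂, ¬ G.ShareEdge t₁ t₂ ∧ 0 ≤ G.reach t₁ ∧ 0 ≤ G.reach t₂ := by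
  obtain ⟨t₁, t₂, hd, h₁, h₂⟩ := h
  have key : ∀ t, F.depth t = F.height → ∃ s : F.prune.V, F.OnTine s.1 t ∧ 0 ≤ F.prune.reach s := by
    intro t ht
    obtain ⟨s, hs, ho, hle⟩ := F.exists_hasHonest_onTine t
    refine ⟨⟨s, hs⟩, ho, ?_⟩
    have hr : F.prune.reserve ⟨s, hs⟩ = F.reserve s := rfl
    have hD := F.depth_prune ⟨s, hs⟩
    have hH := F.height_prune_le
    unfold reach gap
    rw [hr, hD]
    simp only
    omega
  obtain ⟨s₁, ho₁, hr₁⟩ := key t₁ h₁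
  obtain ⟨s₂, ho₂, hr₂⟩ := key t₂ h₂
  exact ⟨F.prune, F.prune_isClosed, s₁, s₂, fun h => hd ((h.of_prune F).mono F ho₁ ho₂), hr₁, hr₂⟩

/-! ### Adding an adversarial leaf -/

/-- The parent map after a child of `t` is added. -/
def addLeafParent (t : F.V) (v : Option F.V) : Option F.V :=
  some (v.elim t F.parent)

lemma iterate_addLeafParent_some (t : F.V) (k : ℕ) (v : F.V) :
    (F.addLeafParent t)^[k] (some v) = some (F.parent^[k] v) := by
  induction k generalizing v with
  | zero => rfl
  | succ k ih => rw [Function.iterate_succ_apply, Function.iterate_succ_apply, ← ih]; rfl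

/-- Add a child of `t` that is labeled with an adversarial slot after `t`. -/
def addLeaf (t : F.V) (i : Fin n) (hw : w i = true) (hi : F.label t < i.succ) : Fork w where
  V := Option F.V
  root := some F.root
  parent := F.addLeafParent t
  parent_root := congrArg some F.parent_root
  exists_iterate_parent v := by
    cases v with
    | none =>
      obtain ⟨k, hk⟩ := F.exists_iterate_parent t
      refine ⟨k + 1, ?_⟩
      rw [Function.iterate_succ_apply, ← hk]
      exact F.iterate_addLeafParent_some t k t
    | some v =>
      obtain ⟨k, hk⟩ := F.exists_iterate_parent v
      exact ⟨k, by rw [iterate_addLeafParent_some, hk]⟩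
  label v := v.elim i.succ F.label
  label_root := F.label_root
  label_lt v hv := by
    cases v with
    | none => exact hi
    | some v => exact F.label_lt v fun h => hv (congrArg some h)
  honest_unique j hj := by
    obtain ⟨v, hv, hu⟩ := F.honest_unique j hj
    refine ⟨some v, hv, fun u h => ?_⟩
    cases u with
    | none =>
      obtain rfl : i = j := Fin.succ_injective _ h
      simp [hw] at hj
    | some u => exact congrArg some (hu u h)
  honest_depth j k hj hk hjk u v hu hv := by
    cases u with
    | none =>
      obtain rfl : i = j := Fin.succ_injective _ hu
      simp [hw] at hj
    | some u =>
      cases v with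
      | none =>
        obtain rfl : i = k := Fin.succ_injective _ hv
        simp [hw] at hk
      | some v =>
        simp only [iterate_addLeafParent_some, Option.some.injEq]
        exact F.honest_depth j k hj hk hjk u v hu hv

section AddLeaf

variable (t : F.V) (i : Fin n) (hw : w i = true) (hi : F.label t < i.succ)

lemma depth_addLeaf_some (v : F.V) : (F.addLeaf t i hw hi).depth (some v) = F.depth v := by
  refine congrArg sInf (Set.ext fun k => ?_)
  change (F.addLeafParent t)^[k] (some v) = some F.root ↔ _
  rw [iterate_addLeafParent_some, Option.some.injEq]
  rfl

lemma depth_addLeaf_none : (F.addLeaf t i hw hi).depth none = F.depth t + 1 := by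
  refine ((F.addLeaf t i hw hi).depth_eq_succ (v := none) (Option.some_ne_none F.root).symm).trans ?_
  exact congrArg (· + 1) (F.depth_addLeaf_some t i hw hi t)

lemma height_addLeaf (h : F.depth t < F.height) : (F.addLeaf t i hw hi).height = F.height := by
  apply le_antisymm
  · refine Finset.sup_le fun v _ => ?_
    cases v with
    | none => exact (F.depth_addLeaf_none t i hw hi).trans_le h
    | some v => exact (F.depth_addLeaf_some t i hw hi v).trans_le (F.depth_le_height v)
  · exact Finset.sup_le fun v _ =>
      (F.depth_addLeaf_some t i hw hi v).symm.trans_le ((F.addLeaf t i hw hi).depth_le_height _)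

lemma ShareEdge.of_addLeaf {s : F.V}
    (h : (F.addLeaf t i hw hi).ShareEdge none (some s)) : F.ShareEdge t s := by
  obtain ⟨u, v, ⟨hv, -⟩, ⟨k, hk⟩, ⟨l, hl⟩⟩ := h
  replace hk : (F.addLeafParent t)^[k] none = v := hk
  replace hl : (F.addLeafParent t)^[l] (some s) = v := hl
  rw [iterate_addLeafParent_some] at hl
  subst hl
  cases k with
  | zero => simp at hk
  | succ k =>
    rw [Function.iterate_succ_apply] at hk
    replace hk : (F.addLeafParent t)^[k] (some t) = _ := hk
    rw [iterate_addLeafParent_some, Option.some.injEq] at hk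
    exact ⟨_, F.parent^[l] s, ⟨fun h => hv (congrArg some h), rfl⟩, ⟨k, hk⟩, ⟨l, rfl⟩⟩

end AddLeaf

/-- A tine with positive reserve can be extended at the cost of at most one unit of reserve. -/
lemma exists_next_slot {t : F.V} (h : 0 < F.reserve t) :
    ∃ (i : Fin n) (hw : w i = true) (hi : F.label t < i.succ),
      F.reserve t ≤ (F.addLeaf t i hw hi).reserve none + 1 := by
  -- Taking the earliest available slot keeps all the others in reserve.
  obtain ⟨i, hi, hmin⟩ := Finset.exists_min_image
    (Finset.univ.filter fun i : Fin n => w i = true ∧ F.label t < i.succ) id (Finset.card_pos.1 h)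
  have hi' := (Finset.mem_filter.1 hi).2
  refine ⟨i, hi'.1, hi'.2, ?_⟩
  refine (Finset.card_le_card (t := insert i (Finset.univ.filter fun j : Fin n =>
    w j = true ∧ i.succ < j.succ)) fun j hj => ?_).trans (Finset.card_insert_le _ _)
  rcases eq_or_lt_of_le (hmin j hj) with h | h
  · exact Finset.mem_insert.2 (Or.inl h.symm)
  · exact Finset.mem_insert_of_mem (Finset.mem_filter.2
      ⟨Finset.mem_univ _, (Finset.mem_filter.1 hj).2.1, Fin.succ_lt_succ_iff.2 h⟩)

/-- A tine shorter than the height has positive gap, hence positive reserve, and can be extended by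
an adversarial leaf without lowering its reach or changing the height. The induction is on the sum
of the two gaps. -/
lemma forkable_of_reach_nonneg {t₁ t₂ : F.V} (hd : ¬ F.ShareEdge t₁ t₂) (h₁ : 0 ≤ F.reach t₁)
    (h₂ : 0 ≤ F.reach t₂) : w.Forkable := by
  induction hN : (F.height - F.depth t₁) + (F.height - F.depth t₂) using Nat.strong_induction_on
    generalizing F with
  | _ N ih =>
  have step : ∀ (s₁ s₂ : F.V), ¬ F.ShareEdge s₁ s₂ → 0 ≤ F.reach s₁ → 0 ≤ F.reach s₂ →
      F.depth s₁ < F.height →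
      (F.height - F.depth s₁) + (F.height - F.depth s₂) = N → w.Forkable := by
    intro s₁ s₂ hd h₁ h₂ hlt hN
    obtain ⟨i, hw, hi, hr⟩ := F.exists_next_slot (t := s₁) (by unfold reach gap at h₁; omega)
    have e₁ := F.depth_addLeaf_none s₁ i hw hi
    have e₂ := F.depth_addLeaf_some s₁ i hw hi s₂
    have e₃ := F.height_addLeaf s₁ i hw hi hlt
    have e₄ : (F.addLeaf s₁ i hw hi).reserve (some s₂) = F.reserve s₂ := rfl
    refine ih _ ?_ (F.addLeaf s₁ i hw hi) (t₁ := none) (t₂ := some s₂)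
      (fun h => hd (h.of_addLeaf F s₁ i hw hi)) ?_ ?_ rfl
    · rw [e₁, e₂, e₃]
      omega
    · unfold reach gap at h₁ ⊢
      rw [e₁, e₃]
      omega
    · unfold reach gap at h₂ ⊢
      rw [e₂, e₃, e₄]
      exact h₂
  rcases (F.depth_le_height t₁).lt_or_eq with hlt | he₁
  · exact step t₁ t₂ hd h₁ h₂ hlt hN
  rcases (F.depth_le_height t₂).lt_or_eq with hlt | he₂
  · exact step t₂ t₁ (fun h => hd (h.symm F)) h₂ h₁ hlt (by omega)
  exact ⟨F, t₁, t₂, hd, he₁, he₂⟩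

/-! ### Existence of a fork -/

/-- The path whose vertices carry all the labels. -/
def path (w : CharString n) : Fork w where
  V := Fin (n + 1)
  root := 0
  parent v := ⟨v.1 - 1, by omega⟩
  parent_root := rfl
  exists_iterate_parent v := by
    have h : ∀ (k : ℕ) (v : Fin (n + 1)),
        ((fun v : Fin (n + 1) => (⟨v.1 - 1, by omega⟩ : Fin (n + 1)))^[k] v).val = v.1 - k := by
      intro k
      induction k with
      | zero => intro v; rfl
      | succ k ih => intro v; rw [Function.iterate_succ_apply, ih]; simp only; omega
    exact ⟨v.1, Fin.ext (by rw [h]; simp)⟩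
  label v := v
  label_root := rfl
  label_lt v hv := by
    have : v.1 ≠ 0 := fun h => hv (Fin.ext h)
    exact Fin.lt_def.2 (by simp only; omega)
  honest_unique i _ := ⟨i.succ, rfl, fun _ h => h⟩
  honest_depth i j _ _ hij u v hu hv := by
    have h : ∀ (k : ℕ) (v : Fin (n + 1)),
        ((fun v : Fin (n + 1) => (⟨v.1 - 1, by omega⟩ : Fin (n + 1)))^[k] v).val = v.1 - k := by
      intro k
      induction k with
      | zero => intro v; rfl
      | succ k ih => intro v; rw [Function.iterate_succ_apply, ih]; simp only; omega
    have hs : ∀ v : Fin (n + 1), sInf {k : ℕ | (fun v : Fin (n + 1) =>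
        (⟨v.1 - 1, by omega⟩ : Fin (n + 1)))^[k] v = 0} = v.1 := by
      intro v
      have : {k : ℕ | (fun v : Fin (n + 1) =>
          (⟨v.1 - 1, by omega⟩ : Fin (n + 1)))^[k] v = 0} = Set.Ici v.1 := by
        ext k
        rw [Set.mem_ofPred_eq, Fin.ext_iff, h]
        simp [Nat.sub_eq_zero_iff_le]
      rw [this, csInf_Ici]
    rw [hs, hs, hu, hv]
    exact Fin.succ_lt_succ_iff.2 hij

/-! ### The margin -/

lemma reach_le (t : F.V) : F.reach t ≤ n := by
  have h₁ : F.reserve t ≤ n := (Finset.card_le_univ _).trans_eq (Fintype.card_fin n)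
  have h₂ := F.depth_le_height t
  unfold reach gap
  omega

lemma margin_bddAbove :
    BddAbove {m : ℤ | ∃ t₁ t₂, ¬ F.ShareEdge t₁ t₂ ∧ m = min (F.reach t₁) (F.reach t₂)} := by
  refine ⟨n, ?_⟩
  rintro _ ⟨t₁, t₂, -, rfl⟩
  exact (min_le_left _ _).trans (F.reach_le t₁)

lemma margin_mem :
    ∃ t₁ t₂, ¬ F.ShareEdge t₁ t₂ ∧ F.margin = min (F.reach t₁) (F.reach t₂) :=
  Int.csSup_mem (s := {m | ∃ t₁ t₂, ¬ F.ShareEdge t₁ t₂ ∧ m = min (F.reach t₁) (F.reach t₂)})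
    ⟨_, F.root, F.root, F.not_shareEdge_root, rfl⟩ F.margin_bddAbove

end Fork

/-! ### Forkability and nonnegative margin -/

namespace CharString

variable {n : ℕ} (w : CharString n)

lemma margin_bddAbove : BddAbove {m : ℤ | ∃ F : Fork w, F.IsClosed ∧ m = F.margin} := by
  refine ⟨n, ?_⟩
  rintro _ ⟨F, -, rfl⟩
  obtain ⟨t₁, t₂, -, h⟩ := F.margin_mem
  exact h.trans_le ((min_le_left _ _).trans (F.reach_le t₁))

/-- A closed fork must be exhibited: over an empty set `sSup` would be the default `0`, which is
nonnegative. -/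
lemma margin_mem : ∃ F : Fork w, F.IsClosed ∧ w.margin = F.margin :=
  Int.csSup_mem (s := {m | ∃ F : Fork w, F.IsClosed ∧ m = F.margin})
    ⟨_, (Fork.path w).prune, (Fork.path w).prune_isClosed, rfl⟩ w.margin_bddAbove

/-- A string is forkable if and only if its margin is nonnegative. -/
theorem forkable_iff_margin_nonneg : w.Forkable ↔ 0 ≤ w.margin := by
  constructor
  · rintro ⟨F, hF⟩
    obtain ⟨G, hG, t₁, t₂, hd, h₁, h₂⟩ := hF.exists_closed F
    calc (0 : ℤ) ≤ min (G.reach t₁) (G.reach t₂) := le_min h₁ h₂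
      _ ≤ G.margin := le_csSup G.margin_bddAbove ⟨t₁, t₂, hd, rfl⟩
      _ ≤ w.margin := le_csSup w.margin_bddAbove ⟨G, hG, rfl⟩
  · intro h
    obtain ⟨F, -, hF⟩ := w.margin_mem
    obtain ⟨t₁, t₂, hd, hm⟩ := F.margin_mem
    have h' : 0 ≤ min (F.reach t₁) (F.reach t₂) := hm ▸ hF ▸ h
    exact F.forkable_of_reach_nonneg hd (le_min_iff.1 h').1 (le_min_iff.1 h').2

lemma bounds_nonneg_of_forkable (h : w.Forkable) : 0 ≤ w.bounds.2 := by
  obtain ⟨F, hF⟩ := h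
  exact hF.bounds_nonneg F

end CharString

/-! ### The potential and its drift -/

namespace CharString

/-- An exponential potential on the pairs of bounds for the reach and the margin. -/
noncomputable def potential (ε : ℝ) (s : ℤ × ℤ) : ℝ :=
  (1 + ε ^ 2) ^ s.1 * (1 + ε) ^ (min s.2 0)

section Potential

variable {ε : ℝ}

lemma potential_nonneg (hε₀ : 0 < ε) (s : ℤ × ℤ) : 0 ≤ potential ε s := by
  unfold potential
  positivity

lemma one_le_potential {s : ℤ × ℤ} (h₁ : 0 ≤ s.1) (h₂ : 0 ≤ s.2) :
    1 ≤ potential ε s := by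
  rw [potential, min_eq_right h₂, zpow_zero, mul_one]
  exact one_le_zpow₀ (by nlinarith [sq_nonneg ε]) h₁

/-- This makes (1 - ε)/2 the worst case among the allowed probabilities of an adversarial bit. -/
lemma potential_step_mono (hε₀ : 0 < ε) {s : ℤ × ℤ} (h₁ : 0 ≤ s.1) :
    potential ε (boundStep false s) ≤ potential ε (boundStep true s) := by
  have hx : 1 ≤ 1 + ε ^ 2 := by nlinarith [sq_nonneg ε]
  have hy : 1 ≤ 1 + ε := by linarith
  have h : (boundStep false s).2 ≤ (boundStep true s).2 := by
    simp only [boundStep, Bool.false_eq_true, if_false, if_true]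
    split_ifs <;> omega
  refine mul_le_mul (zpow_le_zpow_right₀ hx ?_) (zpow_le_zpow_right₀ hy (min_le_min_right 0 h))
    (by positivity) (by positivity)
  simp only [boundStep, Bool.false_eq_true, if_false, if_true]
  omega

/-- The potential decreases in expectation. -/
lemma potential_drift (hε₀ : 0 < ε) (hε₁ : ε < 1) {s : ℤ × ℤ} (h₁ : 0 ≤ s.1) (h₂ : s.2 ≤ s.1) :
    (1 - ε) / 2 * potential ε (boundStep true s) + (1 + ε) / 2 * potential ε (boundStep false s) ≤
      (1 - ε ^ 4 / 2) * potential ε s := by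
  obtain ⟨ρ, μ⟩ := s
  simp only at h₁ h₂
  simp only [potential, boundStep, Bool.false_eq_true, if_false, if_true]
  have hx : (1 + ε ^ 2) ≠ 0 := by positivity
  have hy : (1 + ε) ≠ 0 := by positivity
  -- The case ρ > 0, μ ≥ 0: the second factor stays 1, and only the drift of ρ counts.
  have hX : (1 - ε) / 2 * (1 + ε ^ 2) + (1 + ε) / 2 * (1 + ε ^ 2)⁻¹ ≤ 1 - ε ^ 4 / 2 := by
    rw [← sub_nonneg]
    have : 1 - ε ^ 4 / 2 - ((1 - ε) / 2 * (1 + ε ^ 2) + (1 + ε) / 2 * (1 + ε ^ 2)⁻¹) =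
        ε ^ 3 * (1 - ε) * (2 + ε ^ 2) / 2 * (1 + ε ^ 2)⁻¹ := by
      field_simp
      ring
    rw [this]
    have : 0 < 1 - ε := by linarith
    positivity
  -- The case ρ = 0, μ < 0, which fixes the rate: an honest bit cannot lower ρ, so the drift of μ
  -- must pay for the possible rise of ρ. The base 1 + ε² is close enough to 1 for this.
  have hY : (1 - ε) / 2 * ((1 + ε ^ 2) * (1 + ε)) + (1 + ε) / 2 * (1 + ε)⁻¹ = 1 - ε ^ 4 / 2 := by
    field_simp
    ring
  rcases h₁.eq_or_lt with rfl | hρ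
  · rcases h₂.eq_or_lt with rfl | hμ
    · norm_num
      have : 0 < (1 - ε) * ((1 + ε ^ 2) * ε) := by
        have : 0 < 1 - ε := by linarith
        positivity
      nlinarith
    · rw [min_eq_left (by omega), min_eq_left (by omega), min_eq_left hμ.le]
      norm_num
      rw [zpow_add₀ hy, zpow_sub₀ hy, zpow_one, ← hY]
      apply le_of_eq
      field_simp
  · rw [max_eq_left (by omega), zpow_add₀ hx, zpow_sub₀ hx, zpow_one]
    rcases lt_or_ge μ 0 with hμ | hμ
    · rw [if_neg (by omega), min_eq_left (by omega), min_eq_left (by omega), min_eq_left hμ.le,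
        zpow_add₀ hy, zpow_sub₀ hy, zpow_one]
      have hinv : (1 + ε ^ 2)⁻¹ ≤ 1 := inv_le_one_of_one_le₀ (by nlinarith [sq_nonneg ε])
      have hXY : (1 - ε) / 2 * ((1 + ε ^ 2) * (1 + ε)) +
          (1 + ε) / 2 * ((1 + ε ^ 2)⁻¹ * (1 + ε)⁻¹) ≤ 1 - ε ^ 4 / 2 := by
        rw [← hY]
        gcongr
        exact mul_le_of_le_one_left (by positivity) hinv
      calc _ = ((1 - ε) / 2 * ((1 + ε ^ 2) * (1 + ε)) +
          (1 + ε) / 2 * ((1 + ε ^ 2)⁻¹ * (1 + ε)⁻¹)) * ((1 + ε ^ 2) ^ ρ * (1 + ε) ^ μ) := by ring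
        _ ≤ _ := mul_le_mul_of_nonneg_right hXY (by positivity)
    -- With ρ > 0, an honest bit cannot take μ from zero to a negative value.
    · have e : min (if 0 < ρ ∧ μ = 0 then 0 else μ - 1) 0 = 0 := by
        split_ifs <;> omega
      rw [e, min_eq_right (by omega), min_eq_right hμ, zpow_zero]
      calc _ = ((1 - ε) / 2 * (1 + ε ^ 2) + (1 + ε) / 2 * (1 + ε ^ 2)⁻¹) *
          ((1 + ε ^ 2) ^ ρ * 1) := by ring
        _ ≤ _ := mul_le_mul_of_nonneg_right hX (by positivity)

end Potential

end CharString

/-! ### The expected potential and the tail bound -/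

namespace MartingaleCondition

open CharString

variable {ε : ℝ} {Ω : Type*} [MeasurableSpace Ω] {P : Measure Ω} {n : ℕ}

/-- The condition is inherited by the string of all bits but the last. -/
lemma init {W : Ω → CharString (n + 1)} (h : MartingaleCondition ε P W) :
    MartingaleCondition ε P fun ω => (Fin.init (W ω) : CharString n) := by
  intro t a ha
  -- The appended bit `true` is arbitrary, since only bits before `t` matter.
  have hs : {ω | ∀ i < t, (Fin.init (W ω) : CharString n) i = a i} =
      {ω | ∀ i < t.castSucc, W ω i = (Fin.snoc a true : CharString (n + 1)) i} := by
    ext ω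
    simp only [Set.mem_ofPred_eq]
    constructor
    · intro H i hi
      obtain ⟨j, rfl⟩ : ∃ j : Fin n, i = j.castSucc :=
        ⟨⟨i.1, lt_trans hi t.2⟩, rfl⟩
      simpa [Fin.init] using H j hi
    · intro H i hi
      simpa [Fin.init] using H i.castSucc hi
  rw [hs] at ha ⊢
  exact h t.castSucc _ ha

variable [IsProbabilityMeasure P]

/-- A prefix is followed by an adversarial bit with conditional probability at most
`(1 - ε) / 2`. -/
lemma measureReal_snoc_true_le {W : Ω → CharString (n + 1)} (hW : Measurable W)
    (h : MartingaleCondition ε P W) (a : CharString n) :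
    P.real {ω | W ω = Fin.snoc a true} ≤
      (1 - ε) / 2 * P.real {ω | (Fin.init (W ω) : CharString n) = a} := by
  set A := {ω | (Fin.init (W ω) : CharString n) = a} with hA
  have hsub : {ω | W ω = Fin.snoc a true} = A ∩ {ω | W ω (Fin.last n) = true} := by
    ext ω
    simp only [hA, Set.mem_ofPred_eq, Set.mem_inter_iff]
    constructor
    · intro e
      rw [e]
      simp
    · rintro ⟨rfl, e₂⟩
      rw [← e₂]
      exact (Fin.snoc_init_self _).symm
  have hAm : MeasurableSet A :=
    hW (MeasurableSet.of_discrete (s := {x : CharString (n + 1) | Fin.init x = a}))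
  have hAe : A = {ω | ∀ i < Fin.last n, W ω i = (Fin.snoc a true : CharString (n + 1)) i} := by
    ext ω
    simp only [hA, Set.mem_ofPred_eq]
    constructor
    · rintro rfl i hi
      obtain ⟨j, rfl⟩ := Fin.exists_castSucc_eq.2 hi.ne
      simp [Fin.init]
    · intro H
      funext i
      simpa [Fin.init] using H i.castSucc (Fin.castSucc_lt_last i)
  rw [hsub]
  by_cases h0 : P A = 0
  · have : P.real (A ∩ {ω | W ω (Fin.last n) = true}) = 0 := by
      rw [measureReal_def, measure_mono_null Set.inter_subset_left h0, ENNReal.toReal_zero]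
    rw [this, measureReal_def, h0]
    simp
  · have hc := h (Fin.last n) (Fin.snoc a true) (hAe ▸ h0)
    rw [← hAe, measureReal_def, cond_apply hAm, ENNReal.toReal_mul, ENNReal.toReal_inv,
      ← measureReal_def, ← measureReal_def] at hc
    have hpos : 0 < P.real A := ENNReal.toReal_pos h0 (measure_ne_top _ _)
    rwa [inv_mul_le_iff₀ hpos, mul_comm] at hc

lemma measureReal_snoc_add {W : Ω → CharString (n + 1)} (hW : Measurable W) (a : CharString n) :
    P.real {ω | W ω = Fin.snoc a true} + P.real {ω | W ω = Fin.snoc a false} =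
      P.real {ω | (Fin.init (W ω) : CharString n) = a} := by
  rw [← measureReal_union]
  · congr 1
    ext ω
    simp only [Set.mem_union, Set.mem_ofPred_eq]
    constructor
    · rintro (e | e) <;> rw [e] <;> simp
    · rintro rfl
      cases e : W ω (Fin.last n)
      · exact Or.inr (by rw [← e]; exact (Fin.snoc_init_self _).symm)
      · exact Or.inl (by rw [← e]; exact (Fin.snoc_init_self _).symm)
  · rw [Set.disjoint_left]
    intro ω h₁ h₂
    have := congrFun ((Set.mem_ofPred_eq ▸ h₁ : W ω = _).symm.trans h₂) (Fin.last n)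
    simp at this
  · exact hW (MeasurableSet.of_discrete (s := {x : CharString (n + 1) | x = Fin.snoc a false}))

/-- The sum is the expected potential. Splitting off the last bit and conditioning on the others
turns the one-step drift into a geometric bound. -/
lemma sum_potential_le (hε₀ : 0 < ε) (hε₁ : ε < 1) {W : Ω → CharString n} (hW : Measurable W)
    (h : MartingaleCondition ε P W) :
    ∑ a : CharString n, P.real {ω | W ω = a} * potential ε a.bounds ≤ (1 - ε ^ 4 / 2) ^ n := by
  induction n with
  | zero =>
    simp [bounds, potential]
  | succ n ih =>
    have hr : 0 ≤ 1 - ε ^ 4 / 2 := by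
      have : ε ^ 4 ≤ 1 := pow_le_one₀ hε₀.le hε₁.le
      linarith
    have hW' : Measurable fun ω => (Fin.init (W ω) : CharString n) :=
      (Measurable.of_discrete (f := fun x : CharString (n + 1) => (Fin.init x : CharString n))).comp
        hW
    calc ∑ a : CharString (n + 1), P.real {ω | W ω = a} * potential ε a.bounds
        = ∑ a : CharString n,
          (P.real {ω | W ω = Fin.snoc a true} * potential ε (boundStep true a.bounds) +
            P.real {ω | W ω = Fin.snoc a false} * potential ε (boundStep false a.bounds)) := by
          rw [← (Fin.snocEquiv fun _ => Bool).sum_comp, Fintype.sum_prod_type, Fintype.sum_bool,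
            ← Finset.sum_add_distrib]
          refine Finset.sum_congr rfl fun a _ => ?_
          have hb : ∀ b, bounds (n := n + 1) (Fin.snoc a b) = boundStep b (bounds a) := by
            intro b
            rw [bounds, Fin.snoc_last, Fin.init_snoc]
          rw [← hb, ← hb]
          rfl
      _ ≤ ∑ a : CharString n, (1 - ε ^ 4 / 2) *
          (P.real {ω | (Fin.init (W ω) : CharString n) = a} * potential ε a.bounds) := by
          refine Finset.sum_le_sum fun a _ => ?_
          have h₁ := h.measureReal_snoc_true_le hW a
          have h₂ := measureReal_snoc_add (P := P) hW a
          have h₃ := potential_step_mono hε₀ (bounds_fst_nonneg a)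
          have h₄ := potential_drift hε₀ hε₁ (bounds_fst_nonneg a) (bounds_snd_le_fst a)
          have h₅ : 0 ≤ P.real {ω | (Fin.init (W ω) : CharString n) = a} := measureReal_nonneg
          have h₆ := mul_le_mul_of_nonneg_left h₄ h₅
          -- Unused adversarial probability times the potential difference: what is gained over the
          -- extreme case in `h₆`.
          have h₇ := mul_nonneg (sub_nonneg.2 h₁) (sub_nonneg.2 h₃)
          rw [← h₂] at *
          nlinarith
      _ = (1 - ε ^ 4 / 2) * ∑ a : CharString n,
          P.real {ω | (Fin.init (W ω) : CharString n) = a} * potential ε a.bounds :=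
          (Finset.mul_sum _ _ _).symm
      _ ≤ (1 - ε ^ 4 / 2) * (1 - ε ^ 4 / 2) ^ n := mul_le_mul_of_nonneg_left (ih hW' h.init) hr
      _ = (1 - ε ^ 4 / 2) ^ (n + 1) := (pow_succ' _ _).symm

/-- Markov's inequality, since the potential is at least 1 on this event. -/
lemma measureReal_bounds_nonneg_le (hε₀ : 0 < ε) (hε₁ : ε < 1) {W : Ω → CharString n}
    (hW : Measurable W) (h : MartingaleCondition ε P W) :
    P.real {ω | 0 ≤ (W ω).bounds.2} ≤ (1 - ε ^ 4 / 2) ^ n := by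
  refine le_trans ?_ (h.sum_potential_le hε₀ hε₁ hW)
  have hs : {ω | 0 ≤ (W ω).bounds.2} =
      ⋃ a ∈ Finset.univ.filter fun a : CharString n => 0 ≤ a.bounds.2, {ω | W ω = a} := by
    ext ω
    simp
  rw [hs]
  refine (measureReal_biUnion_finset_le _ _).trans ?_
  refine (Finset.sum_le_sum fun a ha => ?_).trans (Finset.sum_le_sum_of_subset_of_nonneg
    (Finset.subset_univ _) fun a _ _ => mul_nonneg measureReal_nonneg (potential_nonneg hε₀ _))
  exact le_mul_of_one_le_right measureReal_nonneg
    (one_le_potential (bounds_fst_nonneg a) (Finset.mem_filter.1 ha).2)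

end MartingaleCondition

theorem corollary3 (ε : ℝ) (hε₀ : 0 < ε) (hε₁ : ε < 1) :
    ∃ c : ℝ, 0 < c ∧
      ∀ (n : ℕ) (Ω : Type*) [MeasurableSpace Ω] (P : Measure Ω) [IsProbabilityMeasure P]
        (W : Ω → CharString n), Measurable W → MartingaleCondition ε P W →
        P.real {ω | (W ω).Forkable} = P.real {ω | 0 ≤ (W ω).margin} ∧
        P.real {ω | 0 ≤ (W ω).margin} ≤ Real.exp (-(c * n)) := by
  refine ⟨ε ^ 4 / 2, by positivity, fun n Ω _ P _ W hW h => ⟨?_, ?_⟩⟩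
  · simp only [CharString.forkable_iff_margin_nonneg]
  · calc P.real {ω | 0 ≤ (W ω).margin}
        ≤ P.real {ω | 0 ≤ (W ω).bounds.2} := measureReal_mono fun ω hω =>
          (W ω).bounds_nonneg_of_forkable ((W ω).forkable_iff_margin_nonneg.2 hω)
      _ ≤ (1 - ε ^ 4 / 2) ^ n := h.measureReal_bounds_nonneg_le hε₀ hε₁ hW
      _ ≤ Real.exp (-(ε ^ 4 / 2)) ^ n := by
          have : ε ^ 4 ≤ 1 := pow_le_one₀ hε₀.le hε₁.le
          exact pow_le_pow_left₀ (by linarith) (Real.one_sub_le_exp_neg _) n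
      _ = Real.exp (-(ε ^ 4 / 2 * n)) := by
          rw [← Real.exp_nat_mul]
          congr 1
          ring
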